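/- **Theorem 6.5.** Let $d\ge 0$ and let $\alpha=(\alpha_1,\dots,\alpha_{d+1})\in\mathbb R^{d+1}$ and $\beta=(\beta_1,\dots,\beta_d)\in\mathbb R^d$ be strictly increasing sequences. Let $\mathscr T_{d,d}$ be the set of complete binary trees (plane rooted trees in which each internal vertex has a Left and a Right child) with $d$ internal vertices, hence with $d+1$ leaves $\ell_1,\dots,\ell_{d+1}$, enumerated from left to right. Label an internal vertex of $T\in\mathscr T_{d,d}$ by $i$ if it is the closest common ancestor of $\ell_i$ and $\ell_{i+1}$. For $1\le i\le d$ set $$\beta_{T,i}=\sum_{k=1}^{t}\beta_k-\sum_{k=1}^{a}\beta_k-\sum_{k=1}^{b}\beta_k ,$$ where $t$, $a$ and $b$ are the numbers of internal vertices of the subtree of $T$ rooted at the vertex labeled $i$, of the Left subtree and of the Right subtree of that vertex, respectively; put $\beta_{T,0}=\beta_{T,d+1}=0$. Suppose that $(\alpha,\beta)$ is a $\mathscr T$-appropriate pair, that is, for every $T\in\mathscr T_{d,d}$ the numbers $\alpha_i+\beta_{T,i-1}-\beta_{T,i}$ $(1\le i\le d+1)$ strictly increase with $i$. Let $$\operatorname{PermAsso}(\alpha,\beta)=\operatorname{ConvexHull}\Bigl\{\sum_{i=1}^{d+1}\alpha_i\,e_{\pi^{-1}(i)}+\sum_{i=1}^{d}\beta_{T,i}\bigl(e_{\pi^{-1}(i+1)}-e_{\pi^{-1}(i)}\bigr)\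 :\ \pi\in\mathfrak S_{d+1},\ T\in\mathscr T_{d,d}\Bigr\}\subseteq\mathbb R^{d+1},$$ and let $U_d^\alpha=\{x\in\mathbb R^{d+1}: \sum_i x_i=\sum_i\alpha_i\}$. Let $\overline{\mathscr O_{d+1}}$ be the set of ordered set partitions $\mathcal S=(S_1,\dots,S_k)$ of $\{1,\dots,d+1\}$ into $k\ge 2$ nonempty blocks. For such $\mathcal S$ let $e_{\mathcal S}=\sum_{i=1}^k i\sum_{j\in S_i}e_j$, let $t_i=|S_1|+\dots+|S_i|$ for $0\le i\le k$, and let $$b_{\mathcal S}=\Bigl(\sum_{i=1}^{k} i\sum_{j=t_{i-1}+1}^{t_i}\alpha_j\Bigr)+\Bigl(\sum_{j=1}^{d}\beta_j-\sum_{i=1}^{k}\ \sum_{j=1}^{|S_i|-1}\beta_j\Bigr).$$ Then $$\operatorname{PermAsso}(\alpha,\beta)=\bigl\{x\in U_d^\alpha:\ \langle e_{\mathcal S},x\rangle\le b_{\mathcal S}\ \text{ for all }\mathcal S\in\overline{\mathscr O_{d+1}}\bigr\},$$ and each of these inequalities is facet-defining: for every $\mathcal S\in\overline{\mathscr O_{d+1}}$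 the set $\{x\in\operatorname{PermAsso}(\alpha,\beta):\langle e_{\mathcal S},x\rangle=b_{\mathcal S}\}$ is a nonempty face of $\operatorname{PermAsso}(\alpha,\beta)$ of dimension $\dim\operatorname{PermAsso}(\alpha,\beta)-1$. -/

import Mathlib

open scoped Matrix

namespace NestedPermutoAssociahedron

noncomputable section

/-! ### Complete binary trees

A complete binary tree (plane, unlabeled, each internal vertex has a Left and a Right child) is a
term of `BinaryTree Unit`: `nil` is a leaf, `node` is an internal vertex, and `numNodes` counts the
internal vertices. The trees with `d` internal vertices (hence `d + 1` leaves) are those with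
`T.numNodes = d`. -/

/-- `prefixSum β t` is `β₁ + ⋯ + β_t` (for `t ≤ n`). -/
def prefixSum {n : ℕ} (β : Fin n → ℝ) (t : ℕ) : ℝ :=
  ∑ k : Fin n with k.val < t, β k

/-- `val(β, T)`: with `t`, `a`, `b` the numbers of internal vertices of `T`, of its Left subtree and
of its Right subtree, the number `∑_{k ≤ t} β_k - ∑_{k ≤ a} β_k - ∑_{k ≤ b} β_k`
(and `0` for a leaf). -/
def val {n : ℕ} (β : Fin n → ℝ) : BinaryTree Unit → ℝ
  | .nil => 0
  | .node u l r =>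
      prefixSum β (BinaryTree.node u l r).numNodes - prefixSum β l.numNodes
        - prefixSum β r.numNodes

/-- The subtree of `T` rooted at the internal vertex labeled `i`. The labels are `1, …, numNodes`:
an internal vertex is labeled `i` if it is the closest common ancestor of the `i`-th and the
`(i+1)`-st leaf, in left-to-right order. If the Left subtree of the root has `a` internal vertices,
it holds the leaves `1, …, a + 1`; so the closest common ancestor of the leaves `i` and `i + 1` lies
in the Left subtree if `i ≤ a`, is the root if `i = a + 1`, and lies in the Right subtree
otherwise. For `i` not in `1, …, numNodes` the value is a leaf. -/
def subtreeAt : BinaryTree Unit → ℕ → BinaryTree Unit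
  | .nil, _ => .nil
  | .node u l r, i =>
      if i ≤ l.numNodes then subtreeAt l i
      else if i = l.numNodes + 1 then .node u l r
      else subtreeAt r (i - (l.numNodes + 1))

/-- `β_{T,i} = val(β, T_{(i)})` for `1 ≤ i ≤ T.numNodes`. -/
def treeVal {n : ℕ} (β : Fin n → ℝ) (T : BinaryTree Unit) (i : ℕ) : ℝ :=
  val β (subtreeAt T i)

theorem subtreeAt_zero (T : BinaryTree Unit) : subtreeAt T 0 = .nil := by
  induction T with
  | nil => rfl
  | node u l r hl hr => simp [subtreeAt, hl]

theorem subtreeAt_of_numNodes_lt (T : BinaryTree Unit) (i : ℕ) (h : T.numNodes < i) :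
    subtreeAt T i = .nil := by
  induction T generalizing i with
  | nil => rfl
  | node u l r hl hr =>
    simp only [BinaryTree.numNodes] at h
    rw [subtreeAt, if_neg (by omega), if_neg (by omega)]
    exact hr _ (by omega)

/-- The convention `β_{T,0} = 0`. -/
theorem treeVal_zero {n : ℕ} (β : Fin n → ℝ) (T : BinaryTree Unit) : treeVal β T 0 = 0 := by
  simp [treeVal, subtreeAt_zero, val]

/-- The convention `β_{T,d+1} = 0` for a tree with `d` internal vertices. -/
theorem treeVal_numNodes_add_one {n : ℕ} (β : Fin n → ℝ) (T : BinaryTree Unit) :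
    treeVal β T (T.numNodes + 1) = 0 := by
  simp [treeVal, subtreeAt_of_numNodes_lt, val]

/-! ### The nested permuto-associahedron

`Fin (d + 1)` stands for `{1, …, d+1}`, its element `i` for the number `i.val + 1`; likewise for
`Fin d`. -/

/-- The affine space of the `x ∈ ℝ^{d+1}` with `∑ x_i = ∑ α_i`. -/
def U {d : ℕ} (α : Fin (d + 1) → ℝ) : Set (Fin (d + 1) → ℝ) :=
  {x | ∑ i, x i = ∑ i, α i}

/-- The vector `f_i^π = e_{π⁻¹(i+1)} - e_{π⁻¹(i)}`. -/
def fVec {d : ℕ} (π : Equiv.Perm (Fin (d + 1))) (i : Fin d) : Fin (d + 1) → ℝ :=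
  Pi.single (π⁻¹ i.succ) 1 - Pi.single (π⁻¹ i.castSucc) 1

/-- The point `v_{π,T} = ∑_{i=1}^{d+1} α_i e_{π⁻¹(i)} + ∑_{i=1}^{d} β_{T,i} f_i^π`. -/
def vertex {d : ℕ} (α : Fin (d + 1) → ℝ) (β : Fin d → ℝ) (π : Equiv.Perm (Fin (d + 1)))
    (T : BinaryTree Unit) : Fin (d + 1) → ℝ :=
  ∑ i : Fin (d + 1), α i • (Pi.single (π⁻¹ i) 1 : Fin (d + 1) → ℝ)
    + ∑ i : Fin d, treeVal β T (i.val + 1) • fVec π i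

/-- The coefficient `α_i + (β_{T,i-1} - β_{T,i})` of `e_{π⁻¹(i)}` in `v_{π,T}`. -/
def coeff {d : ℕ} (α : Fin (d + 1) → ℝ) (β : Fin d → ℝ) (T : BinaryTree Unit)
    (i : Fin (d + 1)) : ℝ :=
  α i + (treeVal β T i.val - treeVal β T (i.val + 1))

/-- `(α, β)` is a `𝒯`-appropriate pair of strictly increasing sequences. -/
structure IsTreeAppropriate {d : ℕ} (α : Fin (d + 1) → ℝ) (β : Fin d → ℝ) : Prop where
  strictMono_left : StrictMono α
  strictMono_right : StrictMono β
  strictMono_coeff : ∀ T : BinaryTree Unit, T.numNodes = d → StrictMono (coeff α β T)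

/-- The nested permuto-associahedron `PermAsso(α, β)`. -/
def permAsso {d : ℕ} (α : Fin (d + 1) → ℝ) (β : Fin d → ℝ) : Set (Fin (d + 1) → ℝ) :=
  convexHull ℝ {v | ∃ (π : Equiv.Perm (Fin (d + 1))) (T : BinaryTree Unit),
    T.numNodes = d ∧ v = vertex α β π T}

/-! ### Ordered set partitions and the inequalities -/

/-- An ordered set partition `(S_1, …, S_k)` of an `n`-element set; `block i` is the block number
`i.val + 1`. -/
structure OrderedSetPartition (n : ℕ) where
  numBlocks : ℕ
  block : Fin numBlocks → Finset (Fin n)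
  block_nonempty : ∀ i, (block i).Nonempty
  block_disjoint : ∀ i j, i ≠ j → Disjoint (block i) (block j)
  exists_mem_block : ∀ x, ∃ i, x ∈ block i

namespace OrderedSetPartition

variable {n : ℕ} (S : OrderedSetPartition n)

/-- At least two blocks. -/
def Nontrivial : Prop := 2 ≤ S.numBlocks

/-- The entry `t_i = |S_1| + ⋯ + |S_i|` of the type, for `0 ≤ i ≤ k`. -/
def typ (i : ℕ) : ℕ := ∑ j : Fin S.numBlocks with j.val < i, (S.block j).card

/-- The vector `e_𝒮 = ∑_i i • e_{S_i}`, where `e_{S_i} = ∑_{j ∈ S_i} e_j`. -/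
def eVec : Fin n → ℝ :=
  ∑ i : Fin S.numBlocks, ((i.val : ℝ) + 1) • ∑ j ∈ S.block i, (Pi.single j 1 : Fin n → ℝ)

end OrderedSetPartition

/-- The right-hand side
`b_𝒮 = ∑_{i=1}^k i ∑_{j=t_{i-1}+1}^{t_i} α_j + (∑_{j=1}^d β_j - ∑_{i=1}^k ∑_{j=1}^{|S_i|-1} β_j)`.
The blocks are nonempty, so the subtraction `|S_i| - 1` is a true one. -/
def bound {d : ℕ} (α : Fin (d + 1) → ℝ) (β : Fin d → ℝ) (S : OrderedSetPartition (d + 1)) : ℝ :=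
  (∑ i : Fin S.numBlocks, ((i.val : ℝ) + 1) *
      ∑ j : Fin (d + 1) with S.typ i.val ≤ j.val ∧ j.val < S.typ (i.val + 1), α j)
    + (∑ j : Fin d, β j - ∑ i : Fin S.numBlocks, prefixSum β ((S.block i).card - 1))

/-- The inequality `⟨a, x⟩ ≤ b` is facet-defining on `P`: the set of points of `P` where equality
holds is a nonempty face of `P` (the set of all maximizers over `P` of some linear functional) of
dimension `dim P - 1`. The dimension of a nonempty set is that of its affine hull. -/
def IsFacetDefining {n : ℕ} (P : Set (Fin n → ℝ)) (a : Fin n → ℝ) (b : ℝ) : Prop :=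
  {x ∈ P | a ⬝ᵥ x = b}.Nonempty ∧ IsExposed ℝ P {x ∈ P | a ⬝ᵥ x = b} ∧
    Module.finrank ℝ (vectorSpan ℝ {x ∈ P | a ⬝ᵥ x = b}) + 1 = Module.finrank ℝ (vectorSpan ℝ P)

end

end NestedPermutoAssociahedron

namespace NestedPermutoAssociahedron

noncomputable section

/-! ### Sums over the internal vertices of a tree -/

/-! Sort the coordinates of a functional `c` increasingly by `σ`, with consecutive gaps `δ ≥ 0`.
Since the coefficients of each vertex increase, rearrangement shows that for a fixed tree `T` the
best permutation is `σ⁻¹`. Summation by parts turns the value there into `∑ α_i c(σ i)` plus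
`treeSum`, the sum of the gaps weighted by the `β_{T,i}`.

For `c = e_𝒮` the gaps are 0 or 1, a 1 marking a passage to the next block. Convexity of the partial
sums of `β` gives `treeSum ≤ ∑ β - gapSum`, where `gapSum` collects the partial sums of `β` over the
runs of zeros, of lengths `|S_i| - 1`. This is validity of the inequality (`treeSum_add_gapSum_le`).
Equality holds for trees that are heaps for the gaps (`IsHeap.treeSum_add_gapSum`).

Conversely, separate a point `x` outside the polytope by a functional and choose a heap `T` for its
gaps. The nonnegative labelings that are heaps on `T` form a cone generated by 0/1 heaps, and each
of these, with `σ`, encodes one of the inequalities. Adding them bounds the functional at `x` by its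
value at a vertex, a contradiction (`sum_mul_sum_range_le_treeSum`).

Dimensions are counted dually. Functionals constant on the polytope are multiples of the coordinate
sum; those constant on the face of `𝒮` are spanned by the coordinate sum and `e_𝒮`. Swaps within a
block make such a functional constant on blocks, and tree rotations make its jumps between
consecutive blocks equal. -/

/-- The partial sums of a sequence. -/
def cumul (b : ℕ → ℝ) (n : ℕ) : ℝ := ∑ i ∈ Finset.range n, b i

theorem cumul_add (b : ℕ → ℝ) (m n : ℕ) :
    cumul b (m + n) = cumul b m + ∑ i ∈ Finset.range n, b (m + i) :=
  Finset.sum_range_add _ _ _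

theorem cumul_succ (b : ℕ → ℝ) (n : ℕ) : cumul b (n + 1) = cumul b n + b n :=
  Finset.sum_range_succ _ _

theorem cumul_zero (b : ℕ → ℝ) : cumul b 0 = 0 := Finset.sum_range_zero _

/-- Convexity of the partial sums: a window of fixed length weighs more the further right it starts.
-/
theorem cumul_add_sub_le {b : ℕ → ℝ} (hb : Monotone b) {p a : ℕ} (hpa : p ≤ a) (c : ℕ) :
    cumul b (p + c) - cumul b p ≤ cumul b (a + c) - cumul b a := by
  rw [cumul_add, cumul_add, add_sub_cancel_left, add_sub_cancel_left]
  exact Finset.sum_le_sum fun i _ => hb (by omega)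

theorem cumul_add_sub_lt {b : ℕ → ℝ} (hb : StrictMono b) {p a c : ℕ} (hpa : p < a) (hc : 0 < c) :
    cumul b (p + c) - cumul b p < cumul b (a + c) - cumul b a := by
  rw [cumul_add, cumul_add, add_sub_cancel_left, add_sub_cancel_left]
  exact Finset.sum_lt_sum_of_nonempty (by simpa using hc.ne') fun i _ => hb (by omega)

/-- The sum over the internal vertices of `T`, labeled from `0` in left-to-right order, of `δ` at
the label times `B t - B a - B b`, with `t`, `a`, `b` the sizes of the subtree at the vertex and
of its Left and Right subtrees. -/
def treeSum (B : ℕ → ℝ) : BinaryTree Unit → (ℕ → ℝ) → ℝ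
  | .nil, _ => 0
  | .node _ l r, δ =>
      treeSum B l δ
        + (B (l.numNodes + r.numNodes + 1) - B l.numNodes - B r.numNodes) * δ l.numNodes
        + treeSum B r fun i => δ (l.numNodes + 1 + i)

theorem treeSum_congr {B B' : ℕ → ℝ} {δ δ' : ℕ → ℝ} (T : BinaryTree Unit)
    (hB : ∀ i ≤ T.numNodes, B i = B' i) (hδ : ∀ i < T.numNodes, δ i = δ' i) :
    treeSum B T δ = treeSum B' T δ' := by
  induction T generalizing δ δ' with
  | nil => rfl
  | node u l r hl hr =>
    simp only [BinaryTree.numNodes] at hB hδ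
    simp only [treeSum]
    rw [hl (fun i hi => hB i (by omega)) (fun i hi => hδ i (by omega)),
      hr (fun i hi => hB i (by omega)) (fun i hi => hδ (l.numNodes + 1 + i) (by omega)),
      hB _ le_rfl, hB l.numNodes (by omega), hB r.numNodes (by omega), hδ l.numNodes (by omega)]

theorem treeSum_add_mul (B : ℕ → ℝ) (T : BinaryTree Unit) (δ ε : ℕ → ℝ) (m : ℝ) :
    treeSum B T (fun i => δ i + m * ε i) = treeSum B T δ + m * treeSum B T ε := by
  induction T generalizing δ ε with
  | nil => simp [treeSum]
  | node u l r hl hr =>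
    simp only [treeSum]
    rw [hl, hr (fun i => δ (l.numNodes + 1 + i)) fun i => ε (l.numNodes + 1 + i)]
    ring

theorem treeSum_zero (B : ℕ → ℝ) (T : BinaryTree Unit) : treeSum B T (fun _ => 0) = 0 := by
  simpa using treeSum_add_mul B T (fun _ => 0) (fun _ => 0) 1

theorem sum_treeVal_mul {n : ℕ} (β : Fin n → ℝ) (T : BinaryTree Unit) (δ : ℕ → ℝ) :
    ∑ i ∈ Finset.range T.numNodes, treeVal β T (i + 1) * δ i = treeSum (prefixSum β) T δ := by
  induction T generalizing δ with
  | nil => simp [treeSum, BinaryTree.numNodes]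
  | node u l r hl hr =>
    simp only [treeSum]
    rw [BinaryTree.numNodes, add_right_comm, Finset.sum_range_add, Finset.sum_range_succ,
      ← hl, ← hr]
    congr 2
    · refine Finset.sum_congr rfl fun i hi => ?_
      rw [Finset.mem_range] at hi
      rw [treeVal, subtreeAt, if_pos (by omega), treeVal]
    · simp [treeVal, subtreeAt, val, BinaryTree.numNodes, add_right_comm]
    · ext i
      rw [treeVal, subtreeAt, if_neg (by omega), if_neg (by omega), treeVal]
      congr 3
      omega

/-- The two trees related by a rotation at the root give the vertices labeled `a` and
`a + b + 1`, where `a`, `b`, `c` are the sizes of the three subtrees, different weights with the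
same sum. -/
theorem treeSum_sub_treeSum_rotate (B : ℕ → ℝ) (A C D : BinaryTree Unit) (δ : ℕ → ℝ) :
    treeSum B (.node () A (.node () C D)) δ - treeSum B (.node () (.node () A C) D) δ =
      (δ A.numNodes - δ (A.numNodes + C.numNodes + 1)) *
        (B (A.numNodes + C.numNodes + D.numNodes + 2) - B (C.numNodes + D.numNodes + 1)
          - B (A.numNodes + C.numNodes + 1) + B C.numNodes) := by
  simp only [treeSum, BinaryTree.numNodes]
  have h1 : A.numNodes + 1 + C.numNodes = A.numNodes + C.numNodes + 1 := by omega
  have h2 : ∀ i, A.numNodes + 1 + (C.numNodes + 1 + i) = A.numNodes + C.numNodes + 1 + 1 + i := by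
    intro i; omega
  have h3 : A.numNodes + (C.numNodes + D.numNodes + 1) + 1 =
    A.numNodes + C.numNodes + D.numNodes + 2 := by omega
  have h4 : A.numNodes + C.numNodes + 1 + D.numNodes + 1 =
    A.numNodes + C.numNodes + D.numNodes + 2 := by omega
  simp only [h1, h2, h3, h4]
  ring

/-! ### Runs of zeros -/

/-- The length of the run of zeros of `ε` that ends just before `n`, where `p` further zeros are
thought to precede `ε 0`. -/
def zeroRun (ε : ℕ → ℕ) (p : ℕ) : ℕ → ℕ
  | 0 => p
  | n + 1 => if ε n = 0 then zeroRun ε p n + 1 else 0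

/-- The sum, over the zeros of `ε` among `0, …, n - 1`, of the value of `b` at the position of the
zero in its run. -/
def gapSum (b : ℕ → ℝ) (ε : ℕ → ℕ) (p n : ℕ) : ℝ :=
  ∑ i ∈ Finset.range n, if ε i = 0 then b (zeroRun ε p i) else 0

theorem gapSum_succ (b : ℕ → ℝ) (ε : ℕ → ℕ) (p n : ℕ) :
    gapSum b ε p (n + 1) = gapSum b ε p n + if ε n = 0 then b (zeroRun ε p n) else 0 :=
  Finset.sum_range_succ _ _

theorem zeroRun_add (ε : ℕ → ℕ) (p m n : ℕ) :
    zeroRun ε p (m + n) = zeroRun (fun i => ε (m + i)) (zeroRun ε p m) n := by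
  induction n with
  | zero => rfl
  | succ n ih => rw [← add_assoc, zeroRun, zeroRun, ih]

theorem gapSum_add (b : ℕ → ℝ) (ε : ℕ → ℕ) (p m n : ℕ) :
    gapSum b ε p (m + n) =
      gapSum b ε p m + gapSum b (fun i => ε (m + i)) (zeroRun ε p m) n := by
  rw [gapSum, Finset.sum_range_add]
  simp only [zeroRun_add]
  rfl

theorem zeroRun_le (ε : ℕ → ℕ) (n : ℕ) : zeroRun ε 0 n ≤ n := by
  induction n with
  | zero => rfl
  | succ n ih => rw [zeroRun]; split_ifs <;> omega

theorem zeroRun_eq_or (ε : ℕ → ℕ) (p n : ℕ) :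
    zeroRun ε p n = zeroRun ε 0 n ∨ zeroRun ε p n = p + n ∧ zeroRun ε 0 n = n := by
  induction n with
  | zero => exact Or.inr ⟨rfl, rfl⟩
  | succ n ih => simp only [zeroRun]; split_ifs <;> omega

/-- The `p` extra zeros lengthen only the initial run. The gain is largest when that run fills all
of `0, …, n - 1`. -/
theorem gapSum_le {b : ℕ → ℝ} (hb : Monotone b) (ε : ℕ → ℕ) (p n : ℕ) :
    gapSum b ε p n ≤ gapSum b ε 0 n + (cumul b (p + n) - cumul b p - cumul b n) := by
  induction n with
  | zero => simp [gapSum, cumul_zero]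
  | succ n ih =>
    rw [gapSum_succ, gapSum_succ, ← add_assoc, cumul_succ, cumul_succ]
    have h1 : b n ≤ b (p + n) := hb (by omega)
    split_ifs with h
    · rcases zeroRun_eq_or ε p n with h2 | ⟨h2, h3⟩
      · rw [h2]; linarith
      · rw [h2, h3]; linarith
    · linarith

theorem zeroRun_of_forall_eq_zero {ε : ℕ → ℕ} {n : ℕ} (h : ∀ i < n, ε i = 0) :
    zeroRun ε 0 n = n := by
  induction n with
  | zero => rfl
  | succ n ih => rw [zeroRun, if_pos (h n (by omega)), ih fun i hi => h i (by omega)]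

theorem gapSum_of_forall_eq_zero (b : ℕ → ℝ) {ε : ℕ → ℕ} {n : ℕ} (h : ∀ i < n, ε i = 0) :
    gapSum b ε 0 n = cumul b n := by
  refine Finset.sum_congr rfl fun i hi => ?_
  rw [Finset.mem_range] at hi
  rw [if_pos (h i hi), zeroRun_of_forall_eq_zero fun j hj => h j (by omega)]

theorem gapSum_node (b : ℕ → ℝ) (ε : ℕ → ℕ) (m n : ℕ) (h : ε m ≠ 0) :
    gapSum b ε 0 (m + n + 1) =
      gapSum b ε 0 m + gapSum b (fun i => ε (m + 1 + i)) 0 n := by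
  rw [add_right_comm, gapSum_add, gapSum_succ, zeroRun, if_neg h, if_neg h, add_zero]

/-- A root labeled 1 separates the runs of the two subtrees, and its weight accounts exactly for
joining them. A root labeled 0 has no weight but merges the adjacent runs; `gapSum_le` and convexity
bound what the merger gains. -/
theorem treeSum_add_gapSum_le {b : ℕ → ℝ} (hb : Monotone b) (T : BinaryTree Unit) (ε : ℕ → ℕ)
    (hε : ∀ i, ε i ≤ 1) :
    treeSum (cumul b) T (fun i => ε i) + gapSum b ε 0 T.numNodes ≤ cumul b T.numNodes := by
  induction T generalizing ε with
  | nil => simp [treeSum, gapSum, BinaryTree.numNodes, cumul_zero]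
  | node u l r hl hr =>
    have h1 := hl ε hε
    have h2 := hr (fun i => ε (l.numNodes + 1 + i)) fun i => hε _
    simp only [treeSum, BinaryTree.numNodes]
    by_cases h : ε l.numNodes = 0
    · rw [add_right_comm l.numNodes r.numNodes 1, gapSum_add, gapSum_succ, zeroRun, if_pos h,
        if_pos h, h]
      have h3 := gapSum_le hb (fun i => ε (l.numNodes + 1 + i)) (zeroRun ε 0 l.numNodes + 1)
        r.numNodes
      have h4 := cumul_add_sub_le hb (zeroRun_le ε l.numNodes) (1 + r.numNodes)
      rw [← add_assoc, ← add_assoc] at h4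
      rw [cumul_succ b (zeroRun ε 0 l.numNodes)] at h3
      push_cast
      linarith
    · rw [gapSum_node b ε _ _ h]
      have h3 : ε l.numNodes = 1 := by have := hε l.numNodes; omega
      rw [h3]
      push_cast
      linarith

/-! ### Heap-ordered trees -/

/-- `δ` is largest at the root of every subtree of `T`. -/
def IsHeap : BinaryTree Unit → (ℕ → ℝ) → Prop
  | .nil, _ => True
  | .node _ l r, δ =>
      (∀ i < l.numNodes + r.numNodes + 1, δ i ≤ δ l.numNodes) ∧ IsHeap l δ ∧
        IsHeap r fun i => δ (l.numNodes + 1 + i)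

theorem IsHeap.of_le_imp_le {T : BinaryTree Unit} {δ δ' : ℕ → ℝ} (h : IsHeap T δ)
    (hδ : ∀ i j, δ i ≤ δ j → δ' i ≤ δ' j) : IsHeap T δ' := by
  induction T generalizing δ δ' with
  | nil => trivial
  | node u l r hl hr =>
    obtain ⟨h1, h2, h3⟩ := h
    exact ⟨fun i hi => hδ _ _ (h1 i hi), hl h2 hδ, hr h3 fun i j => hδ _ _⟩

/-- The Cartesian tree: put a maximum at the root and recurse on both sides. -/
theorem exists_isHeap (n : ℕ) (δ : ℕ → ℝ) :
    ∃ T : BinaryTree Unit, T.numNodes = n ∧ IsHeap T δ := by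
  induction n using Nat.strong_induction_on generalizing δ with
  | _ n ih =>
    rcases Nat.eq_zero_or_pos n with rfl | hn
    · exact ⟨.nil, rfl, trivial⟩
    obtain ⟨a, ha, hmax⟩ := Finset.exists_max_image (Finset.range n) δ ⟨0, by simpa using hn⟩
    simp only [Finset.mem_range] at ha hmax
    obtain ⟨l, hl, hl'⟩ := ih a ha δ
    obtain ⟨r, hr, hr'⟩ := ih (n - a - 1) (by omega) fun i => δ (a + 1 + i)
    refine ⟨.node () l r, by simp only [BinaryTree.numNodes]; omega, ?_, hl', ?_⟩
    · rw [hl, hr]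
      exact fun i hi => hmax i (by omega)
    · rw [hl]; exact hr'

/-- In a heap a root labeled 0 forces the whole subtree to be one run of zeros, so the lossy case of
`treeSum_add_gapSum_le` becomes an equality. -/
theorem IsHeap.treeSum_add_gapSum {b : ℕ → ℝ} {T : BinaryTree Unit} {ε : ℕ → ℕ}
    (h : IsHeap T fun i => ε i) (hε : ∀ i, ε i ≤ 1) :
    treeSum (cumul b) T (fun i => ε i) + gapSum b ε 0 T.numNodes = cumul b T.numNodes := by
  induction T generalizing ε with
  | nil => simp [treeSum, gapSum, BinaryTree.numNodes, cumul_zero]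
  | node u l r hl hr =>
    by_cases h0 : ε l.numNodes = 0
    · have h1 : ∀ i < (BinaryTree.node u l r).numNodes, ε i = 0 := fun i hi => by
        have := h.1 i hi
        simp only [h0] at this
        exact Nat.le_zero.1 (by exact_mod_cast this)
      rw [gapSum_of_forall_eq_zero b h1, treeSum_congr (B' := cumul b) (δ' := fun _ => 0) _
        (fun _ _ => rfl) (fun i hi => by rw [h1 i hi, Nat.cast_zero]), treeSum_zero, zero_add]
    · have h1 := hl h.2.1 hε
      have h2 := hr (ε := fun i => ε (l.numNodes + 1 + i)) h.2.2 fun i => hε _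
      simp only [treeSum, BinaryTree.numNodes]
      rw [gapSum_node b ε _ _ h0]
      have h3 : ε l.numNodes = 1 := by have := hε l.numNodes; omega
      rw [h3]
      push_cast
      linarith

/-- A linear functional which is nonnegative on the heap-ordered `0/1` labelings of `T` is so on
all its nonnegative heap-ordered labelings. -/
theorem IsHeap.nonneg_of_forall_indicator {T : BinaryTree Unit} (L : (ℕ → ℝ) → ℝ)
    (hL : ∀ δ ε m, L (fun i => δ i + m * ε i) = L δ + m * L ε)
    (n : ℕ) (h01 : ∀ ε : ℕ → ℕ, (∀ i, ε i ≤ 1) → (∀ i, n ≤ i → ε i = 0) →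
      IsHeap T (fun i => ε i) → 0 ≤ L fun i => ε i) (δ : ℕ → ℝ) (hδ : ∀ i, 0 ≤ δ i) (hn : ∀ i, n ≤ i → δ i = 0) (h : IsHeap T δ) :
    0 ≤ L δ := by
  classical
  induction hk : (Finset.filter (fun i => δ i ≠ 0) (Finset.range n)).card
    using Nat.strong_induction_on generalizing δ with
  | _ k ih =>
    set D := Finset.filter (fun i => δ i ≠ 0) (Finset.range n) with hD
    have hmem : ∀ i, i ∈ D ↔ δ i ≠ 0 := fun i => by
      rw [hD, Finset.mem_filter, Finset.mem_range, and_iff_right_iff_imp]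
      intro hi
      by_contra hin
      exact hi (hn i (by omega))
    rcases D.eq_empty_or_nonempty with h0 | hne
    · have h1 : δ = fun i => δ i + (-1) * δ i := by
        ext i
        have : δ i = 0 := by
          by_contra hi
          have := (hmem i).2 hi
          simp [h0] at this
        simp [this]
      rw [h1, hL]
      linarith
    obtain ⟨j, hj, hmin⟩ := Finset.exists_min_image D δ hne
    have hjpos : 0 < δ j := lt_of_le_of_ne (hδ j) ((hmem j).1 hj).symm
    -- Peel off the least positive value times the indicator of the support: the support shrinks,
    -- and both pieces are monotone in the values of `δ`, so they remain heaps.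
    let ε : ℕ → ℕ := fun i => if δ i = 0 then 0 else 1
    let δ' : ℕ → ℝ := fun i => δ i + (-δ j) * ε i
    have hε : ∀ i, ε i ≤ 1 := fun i => by simp only [ε]; split_ifs <;> omega
    have hδ' : ∀ i, δ i = 0 ∧ δ' i = 0 ∨ δ j ≤ δ i ∧ δ' i = δ i - δ j := fun i => by
      by_cases hi : δ i = 0
      · exact Or.inl ⟨hi, by simp [δ', ε, hi]⟩
      · refine Or.inr ⟨hmin i ((hmem i).2 hi), ?_⟩
        simp [δ', ε, hi, sub_eq_add_neg]
    have hLε : 0 ≤ L fun i => ε i := by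
      refine h01 ε hε (fun i hi => if_pos (hn i hi)) (h.of_le_imp_le fun i i' hii => ?_)
      simp only [ε]
      split_ifs with h1 h2 h2
      · rfl
      · norm_num
      · exact absurd (le_antisymm (h2 ▸ hii) (hδ i)) h1
      · rfl
    have hLδ' : 0 ≤ L δ' := by
      refine ih _ ?_ δ' (fun i => ?_) (fun i hi => ?_) (h.of_le_imp_le fun i i' hii => ?_) rfl
      · rw [← hk]
        refine Finset.card_lt_card ⟨fun i hi => ?_, fun hsub => ?_⟩
        · rw [hmem]
          intro hi0
          rcases hδ' i with h1 | h1
          · exact (Finset.mem_filter.1 hi).2 h1.2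
          · linarith [h1.1]
        · have := (Finset.mem_filter.1 (hsub hj)).2
          rcases hδ' j with h1 | h1
          · exact this h1.2
          · exact this (by rw [h1.2, sub_self])
      · rcases hδ' i with h1 | h1 <;> linarith [h1.1, h1.2]
      · rcases hδ' i with h1 | h1
        · exact h1.2
        · linarith [h1.1, hn i hi]
      · rcases hδ' i with h1 | h1 <;> rcases hδ' i' with h2 | h2 <;>
          linarith [h1.1, h1.2, h2.1, h2.2]
    have h2 : δ = fun i => δ' i + δ j * ε i := by
      ext i
      simp only [δ']
      ring
    rw [h2, hL]
    positivity

section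

/-! ### Vertices and linear functionals -/

theorem exists_strictMono_prefixSum_eq {n : ℕ} {β : Fin n → ℝ} (hβ : StrictMono β) :
    ∃ b : ℕ → ℝ, StrictMono b ∧ ∀ t ≤ n, prefixSum β t = cumul b t := by
  -- Beyond `n` the values exceed every `β i` and keep increasing, so the convexity lemmas need no
  -- range conditions.
  let b : ℕ → ℝ := fun k => if h : k < n then β ⟨k, h⟩ else (∑ i, |β i|) + 1 + k
  refine ⟨b, fun i j hij => ?_, fun t ht => ?_⟩
  · change (if h : i < n then β ⟨i, h⟩ else _) < if h : j < n then β ⟨j, h⟩ else _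
    split_ifs with h1 h2 h2
    · exact hβ hij
    · have h3 := Finset.single_le_sum (f := fun i => |β i|) (fun i _ => abs_nonneg _)
        (Finset.mem_univ (⟨i, h1⟩ : Fin n))
      have h4 := le_abs_self (β ⟨i, h1⟩)
      have h5 : (0 : ℝ) ≤ j := Nat.cast_nonneg j
      linarith
    · omega
    · have : (i : ℝ) < j := by exact_mod_cast hij
      linarith
  · have h1 : ∀ k : Fin n, β k = b k := fun k => by simp [b]
    have h2 := Fin.sum_univ_eq_sum_range (fun k => if k < t then b k else 0) n
    rw [prefixSum, Finset.sum_filter]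
    simp only [h1]
    rw [h2, ← Finset.sum_filter]
    refine Finset.sum_congr ?_ fun _ _ => rfl
    ext k
    simp only [Finset.mem_filter, Finset.mem_range]
    omega

/-- The element of `Fin (d + 1)` closest to `p`. -/
def clamp (d p : ℕ) : Fin (d + 1) := ⟨min p d, by omega⟩

theorem clamp_val {d : ℕ} (p : Fin (d + 1)) : clamp d p = p :=
  Fin.ext (min_eq_left (by omega))

theorem clamp_of_le {d p : ℕ} (h : d ≤ p) : clamp d p = Fin.last d :=
  Fin.ext (min_eq_right h)

theorem clamp_mono (d : ℕ) : Monotone (clamp d) := fun _ _ h =>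
  Fin.mk_le_mk.2 (min_le_min_right d h)

/-- Summation by parts, with vanishing boundary terms. -/
theorem sum_mul_sub_eq {d : ℕ} (t : ℕ → ℝ) (e : Fin (d + 1) → ℝ) (h0 : t 0 = 0)
    (hd : t (d + 1) = 0) :
    ∑ i : Fin d, t (i + 1) * (e i.succ - e i.castSucc) =
      ∑ i : Fin (d + 1), (t i - t (i + 1)) * e i := by
  simp only [mul_sub, sub_mul, Finset.sum_sub_distrib]
  rw [Fin.sum_univ_succ (fun i : Fin (d + 1) => t i * e i),
    Fin.sum_univ_castSucc (fun i : Fin (d + 1) => t (i + 1) * e i)]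
  simp [h0, hd]

variable {d : ℕ} (α : Fin (d + 1) → ℝ) (β : Fin d → ℝ)

theorem vertex_apply (π : Equiv.Perm (Fin (d + 1))) {T : BinaryTree Unit} (hT : T.numNodes = d)
    (x : Fin (d + 1)) : vertex α β π T x = coeff α β T (π x) := by
  classical
  have h1 : ∀ i, (Pi.single (π⁻¹ i) 1 : Fin (d + 1) → ℝ) x = if i = π x then 1 else 0 := by
    intro i
    rw [Pi.single_apply]
    refine if_congr ?_ rfl rfl
    rw [Equiv.Perm.eq_inv_iff_eq, eq_comm]
  have h2 := sum_mul_sub_eq (treeVal β T) (fun i => if i = π x then 1 else 0)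
    (treeVal_zero β T) (hT ▸ treeVal_numNodes_add_one β T)
  simp only [vertex, fVec, Pi.add_apply, Finset.sum_apply, Pi.smul_apply, Pi.sub_apply, h1,
    smul_eq_mul]
  rw [h2]
  simp [coeff]

theorem sum_coeff_mul {T : BinaryTree Unit} (hT : T.numNodes = d) (c : Fin (d + 1) → ℝ) :
    ∑ i, coeff α β T i * c i = ∑ i, α i * c i
      + treeSum (prefixSum β) T fun i => c (clamp d (i + 1)) - c (clamp d i) := by
  have h2 := sum_mul_sub_eq (treeVal β T) c
    (treeVal_zero β T) (hT ▸ treeVal_numNodes_add_one β T)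
  simp only [coeff, add_mul, Finset.sum_add_distrib]
  rw [← h2, ← sum_treeVal_mul, hT, ← Fin.sum_univ_eq_sum_range
    (fun i => treeVal β T (i + 1) * (c (clamp d (i + 1)) - c (clamp d i)))]
  congr 1
  refine Finset.sum_congr rfl fun i _ => ?_
  rw [← clamp_val i.succ, ← clamp_val i.castSucc]
  rfl

theorem dotProduct_vertex (c : Fin (d + 1) → ℝ) (π : Equiv.Perm (Fin (d + 1)))
    {T : BinaryTree Unit} (hT : T.numNodes = d) :
    c ⬝ᵥ vertex α β π T = ∑ i, coeff α β T i * c (π⁻¹ i) := by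
  rw [dotProduct, ← Equiv.sum_comp π⁻¹]
  simp [vertex_apply α β π hT, mul_comm]

theorem linearMap_apply_eq_dotProduct (f : (Fin (d + 1) → ℝ) →ₗ[ℝ] ℝ) (x : Fin (d + 1) → ℝ) :
    f x = (fun i => f (Pi.single i 1)) ⬝ᵥ x := by
  rw [LinearMap.pi_apply_eq_sum_univ, dotProduct]
  refine Finset.sum_congr rfl fun i _ => ?_
  rw [smul_eq_mul, mul_comm]
  congr 2
  ext j
  simp [Pi.single_apply, eq_comm]

/-! ### Sorting an ordered set partition -/

/-- The partial sums of a sequence of natural numbers. -/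
def height (ε : ℕ → ℕ) (p : ℕ) : ℕ := ∑ j ∈ Finset.range p, ε j

theorem height_succ (ε : ℕ → ℕ) (p : ℕ) : height ε (p + 1) = height ε p + ε p :=
  Finset.sum_range_succ _ _

theorem height_mono (ε : ℕ → ℕ) : Monotone (height ε) :=
  monotone_nat_of_le_succ fun n => by rw [height_succ]; omega

/-- `σ` lists the elements of the blocks of `S` in order, and `ε i = 1` or `ε i = 0` according to
whether a new block starts after the entry `i` of this list. -/
structure IsSorting (S : OrderedSetPartition (d + 1)) (σ : Equiv.Perm (Fin (d + 1)))
    (ε : ℕ → ℕ) : Prop where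
  le_one : ∀ i, ε i ≤ 1
  eq_zero : ∀ i, d ≤ i → ε i = 0
  mem_block_iff : ∀ (i : Fin S.numBlocks) (p : Fin (d + 1)), σ p ∈ S.block i ↔ height ε p = i

theorem exists_isSorting (S : OrderedSetPartition (d + 1)) : ∃ σ ε, IsSorting S σ ε := by
  choose idx hidx using S.exists_mem_block
  have huniq : ∀ i x, x ∈ S.block i ↔ idx x = i := fun i x => by
    refine ⟨fun h => ?_, fun h => h ▸ hidx x⟩
    by_contra hne
    exact Finset.disjoint_left.1 (S.block_disjoint _ _ hne) (hidx x) h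
  let σ := Tuple.sort idx
  have hσ : Monotone (idx ∘ σ) := Tuple.monotone_sort idx
  let f : ℕ → ℕ := fun p => idx (σ (clamp d p))
  have hf : Monotone f := fun p q hpq => hσ (clamp_mono d hpq)
  have hsurj : ∀ i < S.numBlocks, ∃ p : ℕ, f p = i := fun i hi => by
    obtain ⟨x, hx⟩ := S.block_nonempty ⟨i, hi⟩
    refine ⟨(σ.symm x).val, ?_⟩
    simp only [f]
    rw [clamp_val, Equiv.apply_symm_apply, (huniq _ _).1 hx]
  have hlt : ∀ p, f p < S.numBlocks := fun p => (idx _).2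
  have hf0 : f 0 = 0 := by
    obtain ⟨p, hp⟩ := hsurj 0 ((Nat.zero_le _).trans_lt (hlt 0))
    have := hf (Nat.zero_le p)
    omega
  -- A larger jump would skip a block, but every block is nonempty.
  have hstep : ∀ p, f (p + 1) ≤ f p + 1 := fun p => by
    by_contra! hp
    obtain ⟨q, hq⟩ := hsurj (f p + 1) (hp.trans (hlt _))
    rcases Nat.lt_or_ge p q with h | h
    · have := hf (Nat.succ_le_of_lt h)
      simp only [Nat.succ_eq_add_one] at this
      omega
    · have := hf h
      omega
  have hh : ∀ p, height (fun i => f (i + 1) - f i) p = f p := fun p => by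
    induction p with
    | zero => rw [hf0]; rfl
    | succ p ih =>
      rw [height_succ, ih]
      have := hf (Nat.le_succ p)
      simp only [Nat.succ_eq_add_one] at this
      omega
  refine ⟨σ, fun i => f (i + 1) - f i, fun i => ?_, fun i hi => ?_, fun i p => ?_⟩
  · have := hstep i
    omega
  · simp only [f]
    rw [clamp_of_le hi, clamp_of_le (by omega), Nat.sub_self]
  · rw [hh, huniq, Fin.ext_iff]
    simp only [f]
    rw [clamp_val]

variable {S : OrderedSetPartition (d + 1)} {σ : Equiv.Perm (Fin (d + 1))} {ε : ℕ → ℕ}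

namespace IsSorting

theorem height_lt (h : IsSorting S σ ε) (p : Fin (d + 1)) : height ε p < S.numBlocks := by
  obtain ⟨i, hi⟩ := S.exists_mem_block (σ p)
  rw [(h.mem_block_iff i p).1 hi]
  exact i.2

theorem exists_height_eq (h : IsSorting S σ ε) (i : Fin S.numBlocks) :
    ∃ p : Fin (d + 1), height ε p = i := by
  obtain ⟨x, hx⟩ := S.block_nonempty i
  refine ⟨σ.symm x, (h.mem_block_iff i _).1 ?_⟩
  rwa [Equiv.apply_symm_apply]

theorem height_add_one (h : IsSorting S σ ε) : height ε d + 1 = S.numBlocks := by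
  have h1 := h.height_lt (Fin.last d)
  rw [Fin.val_last] at h1
  obtain ⟨p, hp⟩ := h.exists_height_eq ⟨S.numBlocks - 1, by omega⟩
  have h2 := height_mono ε (Nat.lt_succ_iff.1 p.2)
  simp only at hp
  omega

theorem eVec_apply (h : IsSorting S σ ε) (p : Fin (d + 1)) :
    S.eVec (σ p) = height ε p + 1 := by
  classical
  have h1 : ∀ i : Fin S.numBlocks, (σ p ∈ S.block i) ↔ (⟨height ε p, h.height_lt p⟩ = i) :=
    fun i => by rw [h.mem_block_iff, Fin.ext_iff]
  have h2 : S.eVec (σ p) =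
      ∑ i : Fin S.numBlocks, ((i : ℝ) + 1) * if σ p ∈ S.block i then 1 else 0 := by
    simp [OrderedSetPartition.eVec, Finset.sum_apply, Pi.single_apply]
  rw [h2]
  simp [h1]

theorem card_block (h : IsSorting S σ ε) (i : Fin S.numBlocks) :
    (S.block i).card = (Finset.univ.filter fun p : Fin (d + 1) => height ε p = i).card := by
  symm
  rw [← Finset.card_map σ.toEmbedding]
  congr 1
  ext x
  simp only [Finset.mem_map_equiv, Finset.mem_filter, Finset.mem_univ, true_and]
  rw [← h.mem_block_iff, Equiv.apply_symm_apply]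

theorem typ_eq (h : IsSorting S σ ε) (i : ℕ) :
    S.typ i = (Finset.univ.filter fun p : Fin (d + 1) => height ε p < i).card := by
  classical
  rw [OrderedSetPartition.typ, Finset.card_eq_sum_card_fiberwise
    (f := fun p : Fin (d + 1) => (⟨height ε p, h.height_lt p⟩ : Fin S.numBlocks))
    (t := Finset.univ.filter fun j : Fin S.numBlocks => j.val < i)]
  · refine Finset.sum_congr rfl fun j hj => ?_
    rw [h.card_block, Finset.filter_filter]
    congr 1
    ext p
    simp only [Finset.mem_filter, Finset.mem_univ, true_and, Fin.ext_iff] at hj ⊢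
    omega
  · intro p hp
    simpa using hp

theorem typ_le (h : IsSorting S σ ε) (i : ℕ) : S.typ i ≤ d + 1 := by
  rw [h.typ_eq]
  exact (Finset.card_le_univ _).trans_eq (Fintype.card_fin _)

/-- Heights are monotone, so the positions of height less than `i` form an initial segment, of size
`S.typ i`. -/
theorem height_lt_iff (h : IsSorting S σ ε) {p : ℕ} (hp : p ≤ d) (i : ℕ) :
    height ε p < i ↔ p < S.typ i := by
  rw [h.typ_eq]
  let q : Fin (d + 1) := ⟨p, by omega⟩
  constructor
  · intro hi
    have : (Finset.Iic q) ⊆ Finset.univ.filter fun p : Fin (d + 1) => height ε p < i := by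
      intro r hr
      rw [Finset.mem_Iic] at hr
      simpa using (height_mono ε hr).trans_lt hi
    have := Finset.card_le_card this
    rw [Fin.card_Iic] at this
    exact this
  · intro hi
    by_contra! hlt
    have : (Finset.univ.filter fun p : Fin (d + 1) => height ε p < i) ⊆ Finset.Iio q := by
      intro r hr
      rw [Finset.mem_Iio]
      by_contra! hqr
      have h1 := height_mono ε (show p ≤ r from hqr)
      simp only [Finset.mem_filter] at hr
      omega
    have := Finset.card_le_card this
    rw [Fin.card_Iio] at this
    simp only [q] at this
    omega

theorem card_block_eq_sub (h : IsSorting S σ ε) (i : Fin S.numBlocks) :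
    (S.block i).card = S.typ (i + 1) - S.typ i := by
  have : S.typ (i + 1) = S.typ i + (S.block i).card := by
    rw [h.typ_eq, h.typ_eq, h.card_block, ← Finset.card_union_of_disjoint]
    · congr 1
      ext p
      simp only [Finset.mem_filter, Finset.mem_univ, true_and, Finset.mem_union]
      omega
    · rw [Finset.disjoint_left]
      intro p hp hp'
      simp only [Finset.mem_filter, Finset.mem_univ, true_and] at hp hp'
      omega
  omega

/-- A block of `m` entries has `m - 1` inner gaps, hence a run of `m - 1` zeros. The last summand is
the run still open at `n`. -/
theorem gapSum_eq (h : IsSorting S σ ε) (b : ℕ → ℝ) {n : ℕ} (hn : n ≤ d) :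
    gapSum b ε 0 n = ∑ i ∈ Finset.range (height ε n), cumul b (S.typ (i + 1) - S.typ i - 1)
        + cumul b (n - S.typ (height ε n)) ∧
      zeroRun ε 0 n = n - S.typ (height ε n) := by
  induction n with
  | zero => simp [gapSum, height, cumul_zero, zeroRun]
  | succ n ih =>
    obtain ⟨ih1, ih2⟩ := ih (by omega)
    have h1 := h.height_lt_iff (p := n) (by omega) (height ε n)
    have h2 := h.height_lt_iff (p := n) (by omega) (height ε n + 1)
    have h3 := h.height_lt_iff hn (height ε n + 1)
    rw [gapSum_succ, zeroRun, ih1, ih2, height_succ]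
    rw [height_succ] at h3
    by_cases h0 : ε n = 0
    · rw [if_pos h0, if_pos h0, h0, add_zero, add_assoc, ← cumul_succ]
      have h4 : n - S.typ (height ε n) + 1 = n + 1 - S.typ (height ε n) := by omega
      rw [h4]
      exact ⟨rfl, rfl⟩
    · have h4 : ε n = 1 := by have := h.le_one n; omega
      have h5 : S.typ (height ε n + 1) = n + 1 := by omega
      rw [if_neg h0, if_neg h0, h4, h5, Nat.sub_self, cumul_zero, Finset.sum_range_succ, h5]
      have h6 : n + 1 - S.typ (height ε n) - 1 = n - S.typ (height ε n) := by omega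
      rw [h6]
      exact ⟨rfl, rfl⟩

theorem bound_eq (h : IsSorting S σ ε) {b : ℕ → ℝ}
    (hb : ∀ t ≤ d, prefixSum β t = cumul b t) :
    bound α β S = ∑ p, α p * S.eVec (σ p) + (cumul b d - gapSum b ε 0 d) := by
  classical
  have hd : S.typ S.numBlocks = d + 1 := by
    have h1 := h.height_lt_iff le_rfl S.numBlocks
    have h2 := h.height_add_one
    have h3 := h.typ_le S.numBlocks
    omega
  rw [bound]
  congr 1
  · have h1 : ∀ (i : Fin S.numBlocks) (j : Fin (d + 1)),
        (S.typ i ≤ j ∧ (j : ℕ) < S.typ (i + 1)) ↔ (⟨height ε j, h.height_lt j⟩ = i) := by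
      intro i j
      have h1 := h.height_lt_iff (Nat.lt_succ_iff.1 j.2) i
      have h2 := h.height_lt_iff (Nat.lt_succ_iff.1 j.2) (i + 1)
      rw [Fin.ext_iff]
      simp only
      omega
    simp only [h1, Finset.sum_filter, Finset.mul_sum]
    rw [Finset.sum_comm]
    refine Finset.sum_congr rfl fun j _ => ?_
    rw [h.eVec_apply]
    simp [mul_comm]
  · congr 1
    · rw [← hb d le_rfl, prefixSum]
      simp
    · rw [(h.gapSum_eq b le_rfl).1]
      have h1 : ∀ i : Fin S.numBlocks, prefixSum β ((S.block i).card - 1) =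
          cumul b (S.typ (i + 1) - S.typ i - 1) := fun i => by
        have h2 := Finset.card_le_univ (S.block i)
        rw [Fintype.card_fin] at h2
        rw [hb _ (by omega), h.card_block_eq_sub]
      simp only [h1]
      rw [Fin.sum_univ_eq_sum_range (fun i => cumul b (S.typ (i + 1) - S.typ i - 1)),
        ← h.height_add_one, Finset.sum_range_succ, h.height_add_one, hd]
      congr 2
      omega

end IsSorting

end

section

variable {d : ℕ} {α : Fin (d + 1) → ℝ} {β : Fin d → ℝ}
variable {S : OrderedSetPartition (d + 1)} {σ : Equiv.Perm (Fin (d + 1))} {ε : ℕ → ℕ}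

/-! ### The inequalities on the vertices -/

namespace IsSorting

theorem eVec_sub_eVec (h : IsSorting S σ ε) (i : ℕ) :
    S.eVec (σ (clamp d (i + 1))) - S.eVec (σ (clamp d i)) = ε i := by
  rcases Nat.lt_or_ge i d with hi | hi
  · have h1 : (clamp d (i + 1) : ℕ) = i + 1 := min_eq_left hi
    have h2 : (clamp d i : ℕ) = i := min_eq_left hi.le
    rw [h.eVec_apply, h.eVec_apply, h1, h2, height_succ]
    push_cast
    ring
  · rw [clamp_of_le hi, clamp_of_le (by omega), h.eq_zero i hi]
    simp

theorem sum_coeff_mul_eVec (h : IsSorting S σ ε) {b : ℕ → ℝ}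
    (hb : ∀ t ≤ d, prefixSum β t = cumul b t) {T : BinaryTree Unit} (hT : T.numNodes = d) :
    ∑ i, coeff α β T i * S.eVec (σ i) =
      ∑ i, α i * S.eVec (σ i) + treeSum (cumul b) T fun i => ε i := by
  rw [sum_coeff_mul α β hT fun i => S.eVec (σ i)]
  simp only [h.eVec_sub_eVec]
  rw [treeSum_congr T (fun i hi => hb i (hT ▸ hi)) fun _ _ => rfl]

theorem monotone_eVec (h : IsSorting S σ ε) : Monotone fun i => S.eVec (σ i) := fun i j hij => by
  simp only [h.eVec_apply]
  have : (height ε i : ℝ) ≤ height ε j := by exact_mod_cast height_mono ε hij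
  linarith

theorem eVec_dotProduct_vertex_le (h : IsSorting S σ ε) (hαβ : IsTreeAppropriate α β)
    (π : Equiv.Perm (Fin (d + 1))) {T : BinaryTree Unit} (hT : T.numNodes = d) :
    S.eVec ⬝ᵥ vertex α β π T ≤ bound α β S := by
  obtain ⟨b, hb, hB⟩ := exists_strictMono_prefixSum_eq hαβ.strictMono_right
  -- Rearrangement inequality; composing `σ` with this permutation gives `π⁻¹`.
  have h1 := ((hαβ.strictMono_coeff T hT).monotone.monovary
    h.monotone_eVec).sum_mul_comp_perm_le_sum_mul (σ := σ⁻¹ * π⁻¹)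
  simp only [Equiv.Perm.mul_apply, Equiv.Perm.inv_def σ, Equiv.apply_symm_apply] at h1
  have h2 := treeSum_add_gapSum_le hb.monotone T ε h.le_one
  rw [hT] at h2
  rw [dotProduct_vertex α β _ π hT, h.bound_eq α β hB]
  rw [h.sum_coeff_mul_eVec hB hT] at h1
  linarith

theorem eVec_dotProduct_vertex_eq (h : IsSorting S σ ε) (hαβ : IsTreeAppropriate α β)
    {T : BinaryTree Unit} (hT : T.numNodes = d) (hheap : IsHeap T fun i => ε i) :
    S.eVec ⬝ᵥ vertex α β σ⁻¹ T = bound α β S := by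
  obtain ⟨b, -, hB⟩ := exists_strictMono_prefixSum_eq hαβ.strictMono_right
  have h2 := hheap.treeSum_add_gapSum (b := b) h.le_one
  rw [hT] at h2
  rw [dotProduct_vertex α β _ _ hT, h.bound_eq α β hB, inv_inv, h.sum_coeff_mul_eVec hB hT]
  linarith

end IsSorting

theorem vertex_mem_permAsso (π : Equiv.Perm (Fin (d + 1))) {T : BinaryTree Unit}
    (hT : T.numNodes = d) : vertex α β π T ∈ permAsso α β :=
  subset_convexHull ℝ _ ⟨π, T, hT, rfl⟩

theorem dotProduct_le_of_mem_permAsso {c : Fin (d + 1) → ℝ} {r : ℝ}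
    (h : ∀ π T, T.numNodes = d → c ⬝ᵥ vertex α β π T ≤ r) {x : Fin (d + 1) → ℝ}
    (hx : x ∈ permAsso α β) : c ⬝ᵥ x ≤ r := by
  refine convexHull_min (t := {x | c ⬝ᵥ x ≤ r}) ?_ (convex_halfSpace_le
    ⟨dotProduct_add c, fun a x => dotProduct_smul a c x⟩ r) hx
  rintro _ ⟨π, T, hT, rfl⟩
  exact h π T hT

theorem sum_vertex (π : Equiv.Perm (Fin (d + 1))) {T : BinaryTree Unit} (hT : T.numNodes = d) :
    ∑ i, vertex α β π T i = ∑ i, α i := by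
  have h1 := dotProduct_vertex α β (fun _ => 1) π hT
  have h2 := sum_coeff_mul α β hT fun _ => 1
  simp only [sub_self, treeSum_zero] at h2
  simp only [dotProduct, one_mul] at h1
  rw [h1, h2]
  simp

theorem sum_eq_of_mem_permAsso {x : Fin (d + 1) → ℝ} (hx : x ∈ permAsso α β) :
    ∑ i, x i = ∑ i, α i := by
  refine le_antisymm ?_ ?_
  · have := dotProduct_le_of_mem_permAsso (c := fun _ => 1) (r := ∑ i, α i)
      (fun π T hT => by simp [dotProduct, sum_vertex π hT]) hx
    simpa [dotProduct] using this
  · have := dotProduct_le_of_mem_permAsso (c := fun _ => -1) (r := -∑ i, α i)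
      (fun π T hT => by simp [dotProduct, sum_vertex π hT]) hx
    simpa [dotProduct] using this

theorem eVec_dotProduct_le_bound (hαβ : IsTreeAppropriate α β)
    (S : OrderedSetPartition (d + 1)) {x : Fin (d + 1) → ℝ} (hx : x ∈ permAsso α β) :
    S.eVec ⬝ᵥ x ≤ bound α β S := by
  obtain ⟨σ, ε, h⟩ := exists_isSorting S
  exact dotProduct_le_of_mem_permAsso (fun π T hT => h.eVec_dotProduct_vertex_le hαβ π hT) hx

/-! ### The inequalities cut out the polytope -/

theorem exists_height_eq_of_le (hε : ∀ i, ε i ≤ 1) {i n : ℕ} (h : i ≤ height ε n) :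
    ∃ p ≤ n, height ε p = i := by
  induction n with
  | zero => exact ⟨0, le_rfl, (Nat.le_zero.1 h).symm⟩
  | succ n ih =>
    by_cases hi : i ≤ height ε n
    · obtain ⟨p, hp, hp'⟩ := ih hi
      exact ⟨p, by omega, hp'⟩
    · refine ⟨n + 1, le_rfl, ?_⟩
      rw [height_succ] at h ⊢
      have := hε n
      omega

theorem exists_orderedSetPartition (σ : Equiv.Perm (Fin (d + 1))) (hε : ∀ i, ε i ≤ 1)
    (hεd : ∀ i, d ≤ i → ε i = 0) :
    ∃ S : OrderedSetPartition (d + 1), IsSorting S σ ε := by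
  refine ⟨⟨height ε d + 1, fun i => Finset.univ.filter fun x => height ε (σ⁻¹ x) = i,
    fun i => ?_, fun i j hij => ?_, fun x => ?_⟩, hε, hεd, fun i p => ?_⟩
  · obtain ⟨p, hp, hp'⟩ := exists_height_eq_of_le hε (Nat.lt_succ_iff.1 i.2)
    exact ⟨σ ⟨p, by omega⟩, by simpa using hp'⟩
  · rw [Finset.disjoint_left]
    intro x hx hx'
    simp only [Finset.mem_filter] at hx hx'
    exact hij (Fin.ext (hx.2.symm.trans hx'.2))
  · exact ⟨⟨height ε (σ⁻¹ x), Nat.lt_succ_iff.2 (height_mono ε (Nat.lt_succ_iff.1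
      (σ⁻¹ x).2))⟩, by simp⟩
  · simp

theorem sum_mul_sum_range_le_treeSum {b : ℕ → ℝ}
    (hB : ∀ t ≤ d, prefixSum β t = cumul b t) {x : Fin (d + 1) → ℝ} (hxU : x ∈ U α)
    (hx : ∀ S : OrderedSetPartition (d + 1), S.Nontrivial → S.eVec ⬝ᵥ x ≤ bound α β S)
    (σ : Equiv.Perm (Fin (d + 1))) {T : BinaryTree Unit} (hT : T.numNodes = d) {δ : ℕ → ℝ}
    (hδ : ∀ i, 0 ≤ δ i) (hδd : ∀ i, d ≤ i → δ i = 0) (hheap : IsHeap T δ) :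
    ∑ p : Fin (d + 1), (x (σ p) - α p) * ∑ i ∈ Finset.range p, δ i ≤ treeSum (cumul b) T δ := by
  rw [← sub_nonneg]
  refine IsHeap.nonneg_of_forall_indicator (T := T) (fun δ => treeSum (cumul b) T δ -
    ∑ p : Fin (d + 1), (x (σ p) - α p) * ∑ i ∈ Finset.range p, δ i) (fun δ ε m => ?_) d
    (fun ε hε hεd hheap => ?_) δ hδ hδd hheap
  · simp only [treeSum_add_mul, Finset.sum_add_distrib, ← Finset.mul_sum, mul_add,
      mul_left_comm _ m]
    ring
  · obtain ⟨S, hS⟩ := exists_orderedSetPartition σ hε hεd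
    have hcast : ∀ p : ℕ, ∑ i ∈ Finset.range p, (ε i : ℝ) = height ε p := fun p => by
      rw [height, Nat.cast_sum]
    simp only [hcast]
    -- The zero labeling encodes the one-block partition, which has no inequality; both sides
    -- vanish.
    rcases Nat.eq_zero_or_pos (height ε d) with h0 | hpos
    · have h1 : ∀ p : Fin (d + 1), height ε p = 0 := fun p =>
        Nat.le_zero.1 (h0 ▸ height_mono ε (Nat.lt_succ_iff.1 p.2))
      have h2 : ∀ i < T.numNodes, (ε i : ℝ) = 0 := fun i hi => by
        have h3 := height_mono ε (show i + 1 ≤ d by omega)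
        rw [height_succ, h0] at h3
        have : ε i = 0 := by omega
        rw [this, Nat.cast_zero]
      rw [treeSum_congr (B' := cumul b) (δ' := fun _ => 0) T (fun _ _ => rfl) h2, treeSum_zero]
      simp [h1]
    · have h1 := hx S (by have := hS.height_add_one; unfold OrderedSetPartition.Nontrivial; omega)
      have h2 := hheap.treeSum_add_gapSum (b := b) hε
      rw [hT] at h2
      rw [hS.bound_eq α β hB, dotProduct, ← Equiv.sum_comp σ] at h1
      simp only [hS.eVec_apply] at h1
      -- Passing from `height` to `height + 1`, the entry of `e_𝒮`, is free because `x - α` has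
      -- coordinate sum 0.
      have h3 : ∑ p : Fin (d + 1), (x (σ p) - α p) * (height ε p : ℝ) =
          ∑ p : Fin (d + 1), ((height ε p : ℝ) + 1) * x (σ p)
            - ∑ p : Fin (d + 1), α p * ((height ε p : ℝ) + 1) := by
        have h4 : ∑ p, x (σ p) = ∑ p, α p := (Equiv.sum_comp σ x).trans hxU
        have h5 : ∑ p, (x (σ p) - α p) = 0 := by
          rw [Finset.sum_sub_distrib, h4, sub_self]
        rw [← Finset.sum_sub_distrib, ← sub_zero (∑ p : Fin (d + 1), _ * _), ← neg_zero, ← h5,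
          sub_neg_eq_add, ← Finset.sum_add_distrib]
        exact Finset.sum_congr rfl fun p _ => by ring
      rw [h3]
      linarith

theorem finite_setOf_vertex : {v | ∃ (π : Equiv.Perm (Fin (d + 1))) (T : BinaryTree Unit),
    T.numNodes = d ∧ v = vertex α β π T}.Finite := by
  refine ((Set.finite_univ (α := Equiv.Perm (Fin (d + 1)))).prod
    (BinaryTree.treesOfNumNodesEq d).finite_toSet).image
    (fun q => vertex α β q.1 q.2) |>.subset ?_
  rintro _ ⟨π, T, hT, rfl⟩
  exact ⟨(π, T), ⟨Set.mem_univ _, by simpa using hT⟩, rfl⟩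

theorem mem_permAsso_of_forall_le (hαβ : IsTreeAppropriate α β) {x : Fin (d + 1) → ℝ}
    (hxU : x ∈ U α)
    (hx : ∀ S : OrderedSetPartition (d + 1), S.Nontrivial → S.eVec ⬝ᵥ x ≤ bound α β S) :
    x ∈ permAsso α β := by
  obtain ⟨b, -, hB⟩ := exists_strictMono_prefixSum_eq hαβ.strictMono_right
  by_contra hxP
  obtain ⟨f, u, hfu, hux⟩ := geometric_hahn_banach_closed_point (convex_convexHull ℝ _)
    ((finite_setOf_vertex (α := α) (β := β)).isClosed_convexHull ℝ) hxP
  set c : Fin (d + 1) → ℝ := fun i => f (Pi.single i 1) with hc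
  have hf : ∀ y, f y = c ⬝ᵥ y := linearMap_apply_eq_dotProduct f.toLinearMap
  let σ := Tuple.sort c
  have hσ : Monotone (c ∘ σ) := Tuple.monotone_sort c
  let g : ℕ → ℝ := fun p => c (σ (clamp d p))
  have hg : Monotone g := fun p q hpq => hσ (clamp_mono d hpq)
  obtain ⟨T, hT, hheap⟩ := exists_isHeap d fun i => g (i + 1) - g i
  have h1 := sum_mul_sum_range_le_treeSum hB hxU hx σ hT
    (fun i => sub_nonneg.2 (hg (Nat.le_succ i)))
    (fun i hi => by simp only [g]; rw [clamp_of_le hi, clamp_of_le (by omega), sub_self]) hheap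
  have h2 : f (vertex α β σ⁻¹ T) < u := hfu _ (vertex_mem_permAsso σ⁻¹ hT)
  rw [hf, dotProduct_vertex α β c _ hT, inv_inv, sum_coeff_mul α β hT fun i => c (σ i),
    treeSum_congr T (fun i hi => hB i (hT ▸ hi)) fun _ _ => rfl] at h2
  rw [hf, dotProduct, ← Equiv.sum_comp σ] at hux
  simp only [Finset.sum_range_sub] at h1
  have h3 : ∑ p : Fin (d + 1), (x (σ p) - α p) * (g p - g 0) =
      ∑ p, c (σ p) * x (σ p) - ∑ p, α p * c (σ p) := by
    have h4 : ∑ p, x (σ p) = ∑ p, α p := (Equiv.sum_comp σ x).trans hxU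
    have h5 : ∑ p, (x (σ p) - α p) * g 0 = 0 := by
      rw [← Finset.sum_mul, Finset.sum_sub_distrib, h4, sub_self, zero_mul]
    simp only [mul_sub]
    rw [Finset.sum_sub_distrib, h5, sub_zero, ← Finset.sum_sub_distrib]
    refine Finset.sum_congr rfl fun p _ => ?_
    simp only [g, clamp_val]
    ring
  rw [h3] at h1
  linarith

/-! ### Facets -/

theorem mem_dualAnnihilator_vectorSpan_iff {V : Type*} [AddCommGroup V] [Module ℝ V] {s : Set V}
    {f : Module.Dual ℝ V} :
    f ∈ (vectorSpan ℝ s).dualAnnihilator ↔ ∀ x ∈ s, ∀ y ∈ s, f x = f y := by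
  rw [Submodule.mem_dualAnnihilator]
  constructor
  · intro h x hx y hy
    have := h (x -ᵥ y) (vsub_mem_vectorSpan ℝ hx hy)
    rwa [vsub_eq_sub, map_sub, sub_eq_zero] at this
  · intro h
    have : vectorSpan ℝ s ≤ LinearMap.ker f := by
      rw [vectorSpan_def, Submodule.span_le]
      rintro _ ⟨x, hx, y, hy, rfl⟩
      simp [h x hx y hy]
    exact fun w hw => this hw

theorem vertex_sub_vertex_mul_swap {T : BinaryTree Unit} (hT : T.numNodes = d)
    (π : Equiv.Perm (Fin (d + 1))) {x y : Fin (d + 1)} (hxy : x ≠ y) :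
    vertex α β π T - vertex α β (π * Equiv.swap x y) T =
      (coeff α β T (π x) - coeff α β T (π y)) •
        (Pi.single x 1 - Pi.single y 1 : Fin (d + 1) → ℝ) := by
  ext z
  simp only [Pi.sub_apply, Pi.smul_apply, vertex_apply α β _ hT, Equiv.Perm.mul_apply,
    Equiv.swap_apply_def, Pi.single_apply, smul_eq_mul]
  split_ifs with h1 h2 h2
  · exact absurd (h1.symm.trans h2) hxy
  · rw [h1]; ring
  · rw [h2]; ring
  · ring

/-- The two vertices differ by a multiple of `e_x - e_y`, nonzero for `x ≠ y` since the coefficients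
are strictly increasing. -/
theorem apply_single_eq_of_apply_vertex_eq (hαβ : IsTreeAppropriate α β) {T : BinaryTree Unit}
    (hT : T.numNodes = d) (π : Equiv.Perm (Fin (d + 1))) {x y : Fin (d + 1)}
    (f : Module.Dual ℝ (Fin (d + 1) → ℝ))
    (hf : f (vertex α β π T) = f (vertex α β (π * Equiv.swap x y) T)) :
    f (Pi.single x 1) = f (Pi.single y 1) := by
  rcases eq_or_ne x y with rfl | hxy
  · rfl
  have h1 := congrArg f (vertex_sub_vertex_mul_swap (α := α) (β := β) hT π hxy)
  rw [map_sub, map_smul, map_sub, hf, sub_self, smul_eq_mul, eq_comm, mul_eq_zero] at h1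
  rcases h1 with h1 | h1
  · exact absurd (π.injective ((hαβ.strictMono_coeff T hT).injective (sub_eq_zero.1 h1))) hxy
  · exact sub_eq_zero.1 h1

/-- The linear functional `x ↦ ⟨c, x⟩`. -/
def dotLinear (c : Fin (d + 1) → ℝ) : Module.Dual ℝ (Fin (d + 1) → ℝ) where
  toFun x := c ⬝ᵥ x
  map_add' := dotProduct_add c
  map_smul' a x := dotProduct_smul a c x

theorem dotLinear_apply (c x : Fin (d + 1) → ℝ) : dotLinear c x = c ⬝ᵥ x := rfl

theorem eq_dotLinear (f : Module.Dual ℝ (Fin (d + 1) → ℝ)) :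
    f = dotLinear fun i => f (Pi.single i 1) :=
  LinearMap.ext (linearMap_apply_eq_dotProduct f)

theorem dotLinear_one_apply_of_mem {x : Fin (d + 1) → ℝ} (hx : x ∈ permAsso α β) :
    dotLinear (1 : Fin (d + 1) → ℝ) x = ∑ i, α i := by
  rw [← sum_eq_of_mem_permAsso hx]
  simp [dotLinear_apply, dotProduct]

theorem dotLinear_apply_single (c : Fin (d + 1) → ℝ) (i : Fin (d + 1)) :
    dotLinear c (Pi.single i 1) = c i := by
  simp [dotLinear_apply]

theorem dualAnnihilator_vectorSpan_permAsso (hαβ : IsTreeAppropriate α β) :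
    (vectorSpan ℝ (permAsso α β)).dualAnnihilator =
      Submodule.span ℝ {dotLinear (1 : Fin (d + 1) → ℝ)} := by
  ext f
  rw [mem_dualAnnihilator_vectorSpan_iff, Submodule.mem_span_singleton]
  constructor
  · intro h
    obtain ⟨T, hT, -⟩ := exists_isHeap d fun _ => 0
    refine ⟨f (Pi.single 0 1), ?_⟩
    rw [eq_dotLinear f]
    ext i
    simp only [LinearMap.smul_apply, LinearMap.comp_apply, LinearMap.single_apply,
      dotLinear_apply_single]
    simp only [Pi.one_apply, smul_eq_mul, mul_one]
    exact apply_single_eq_of_apply_vertex_eq hαβ hT 1 f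
      (h _ (vertex_mem_permAsso _ hT) _ (vertex_mem_permAsso _ hT))
  · rintro ⟨a, rfl⟩ x hx y hy
    rw [LinearMap.smul_apply, LinearMap.smul_apply, dotLinear_one_apply_of_mem hx,
      dotLinear_one_apply_of_mem hy]

namespace IsSorting

theorem swap_mul (h : IsSorting S σ ε) {x y : Fin (d + 1)}
    (hxy : height ε (σ⁻¹ x) = height ε (σ⁻¹ y)) : IsSorting S (Equiv.swap x y * σ) ε := by
  refine ⟨h.le_one, h.eq_zero, fun i p => ?_⟩
  have h1 : ∀ z, z ∈ S.block i ↔ height ε (σ⁻¹ z) = i := fun z => by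
    rw [← h.mem_block_iff, Equiv.Perm.inv_def, Equiv.apply_symm_apply]
  rw [← h.mem_block_iff, Equiv.Perm.mul_apply, Equiv.swap_apply_def]
  split_ifs with h2 h2
  · rw [h2, h1, h1, hxy]
  · rw [h2, h1, h1, hxy]
  · rfl

theorem vertex_mem_face (h : IsSorting S σ ε) (hαβ : IsTreeAppropriate α β)
    {T : BinaryTree Unit} (hT : T.numNodes = d) (hheap : IsHeap T fun i => ε i) :
    vertex α β σ⁻¹ T ∈ {x ∈ permAsso α β | S.eVec ⬝ᵥ x = bound α β S} :=
  ⟨vertex_mem_permAsso _ hT, h.eVec_dotProduct_vertex_eq hαβ hT hheap⟩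

theorem apply_single_eq_of_height_eq (h : IsSorting S σ ε) (hαβ : IsTreeAppropriate α β)
    {f : Module.Dual ℝ (Fin (d + 1) → ℝ)}
    (hf : ∀ x ∈ {x ∈ permAsso α β | S.eVec ⬝ᵥ x = bound α β S},
      ∀ y ∈ {x ∈ permAsso α β | S.eVec ⬝ᵥ x = bound α β S}, f x = f y)
    {p q : Fin (d + 1)} (hpq : height ε p = height ε q) :
    f (Pi.single (σ p) 1) = f (Pi.single (σ q) 1) := by
  obtain ⟨T, hT, hheap⟩ := exists_isHeap d fun i => ε i
  refine apply_single_eq_of_apply_vertex_eq hαβ hT σ⁻¹ f ?_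
  have h1 : IsSorting S (Equiv.swap (σ p) (σ q) * σ) ε := h.swap_mul (by simpa using hpq)
  have h2 := h1.vertex_mem_face hαβ hT hheap
  rw [mul_inv_rev, Equiv.swap_inv] at h2
  exact hf _ (h.vertex_mem_face hαβ hT hheap) _ h2

/-- Labels `i` and `j` both carry the maximal value 1, so either may be the root with the other just
below it. The two trees differ by a rotation, and both give vertices of the face. -/
theorem sub_eq_sub_of_eq_one (h : IsSorting S σ ε) (hαβ : IsTreeAppropriate α β)
    {f : Module.Dual ℝ (Fin (d + 1) → ℝ)}
    (hf : ∀ x ∈ {x ∈ permAsso α β | S.eVec ⬝ᵥ x = bound α β S},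
      ∀ y ∈ {x ∈ permAsso α β | S.eVec ⬝ᵥ x = bound α β S}, f x = f y)
    {i j : ℕ} (hij : i < j) (hjd : j < d) (hi : ε i = 1) (hj : ε j = 1) :
    f (Pi.single (σ (clamp d (i + 1))) 1) - f (Pi.single (σ (clamp d i)) 1) =
      f (Pi.single (σ (clamp d (j + 1))) 1) - f (Pi.single (σ (clamp d j)) 1) := by
  obtain ⟨b, hb, hB⟩ := exists_strictMono_prefixSum_eq hαβ.strictMono_right
  obtain ⟨A, hA, hA'⟩ := exists_isHeap i fun k => ε k
  obtain ⟨C, hC, hC'⟩ := exists_isHeap (j - i - 1) fun k => ε (i + 1 + k)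
  obtain ⟨D, hD, hD'⟩ := exists_isHeap (d - j - 1) fun k => ε (j + 1 + k)
  have hle : ∀ k, (ε k : ℝ) ≤ 1 := fun k => by exact_mod_cast h.le_one k
  have hn₁ : (BinaryTree.node () A (.node () C D)).numNodes = d := by
    simp only [BinaryTree.numNodes]; omega
  have hn₂ : (BinaryTree.node () (.node () A C) D).numNodes = d := by
    simp only [BinaryTree.numNodes]; omega
  have hj' : i + 1 + (j - i - 1) = j := by omega
  have hj'' : i + (j - i - 1) + 1 = j := by omega
  have h₁ : IsHeap (BinaryTree.node () A (.node () C D)) fun k => ε k := by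
    refine ⟨fun k _ => ?_, hA', fun k _ => ?_, ?_, ?_⟩
    · rw [hA]; simpa [hi] using hle k
    · simp only [hA, hC, hj']; simpa [hj] using hle _
    · rw [hA]; exact hC'
    · rw [hA, hC]
      have : ∀ k, i + 1 + (j - i - 1 + 1 + k) = j + 1 + k := fun k => by omega
      simpa only [this] using hD'
  have h₂ : IsHeap (BinaryTree.node () (.node () A C) D) fun k => ε k := by
    refine ⟨fun k _ => ?_, ⟨fun k _ => ?_, hA', ?_⟩, ?_⟩
    · rw [BinaryTree.numNodes, hA, hC, hj'']; simpa [hj] using hle k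
    · rw [hA]; simpa [hi] using hle k
    · rw [hA]; exact hC'
    · rw [BinaryTree.numNodes, hA, hC, hj'']; exact hD'
  have h3 := hf _ (h.vertex_mem_face hαβ hn₁ h₁) _ (h.vertex_mem_face hαβ hn₂ h₂)
  rw [linearMap_apply_eq_dotProduct f, linearMap_apply_eq_dotProduct f (vertex α β σ⁻¹ _),
    dotProduct_vertex α β _ _ hn₁, dotProduct_vertex α β _ _ hn₂, inv_inv,
    sum_coeff_mul α β hn₁ fun k => f (Pi.single (σ k) 1),
    sum_coeff_mul α β hn₂ fun k => f (Pi.single (σ k) 1), add_right_inj,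
    treeSum_congr _ (fun k hk => hB k (hn₁ ▸ hk)) fun _ _ => rfl,
    treeSum_congr (B := prefixSum β) _ (fun k hk => hB k (hn₂ ▸ hk)) fun _ _ => rfl,
    ← sub_eq_zero, treeSum_sub_treeSum_rotate, hA, hC, hD, hj'', mul_eq_zero] at h3
  rcases h3 with h3 | h3
  · exact sub_eq_zero.1 h3
  -- The other factor compares two windows of length `i + 1`, ending at `j` and at `d`; strict
  -- convexity makes it positive.
  · have h4 := cumul_add_sub_lt hb (show j - i - 1 < j - i - 1 + (d - j - 1) + 1 by omega)
      (Nat.succ_pos i)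
    have e1 : j - i - 1 + i.succ = j := by omega
    have e2 : j - i - 1 + (d - j - 1) + 1 + i.succ = d := by omega
    have e3 : i + (j - i - 1) + (d - j - 1) + 2 = d := by omega
    rw [e1, e2] at h4
    rw [e3] at h3
    linarith

theorem exists_eq_one (h : IsSorting S σ ε) (hS : S.Nontrivial) : ∃ i < d, ε i = 1 := by
  by_contra! hne
  have h0 : height ε d = 0 := Finset.sum_eq_zero fun i hi => by
    have := hne i (Finset.mem_range.1 hi)
    have := h.le_one i
    omega
  have h1 := h.height_add_one
  unfold OrderedSetPartition.Nontrivial at hS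
  omega

theorem dualAnnihilator_vectorSpan_face (h : IsSorting S σ ε) (hαβ : IsTreeAppropriate α β)
    (hS : S.Nontrivial) :
    (vectorSpan ℝ {x ∈ permAsso α β | S.eVec ⬝ᵥ x = bound α β S}).dualAnnihilator =
      Submodule.span ℝ {dotLinear (1 : Fin (d + 1) → ℝ), dotLinear S.eVec} := by
  ext f
  rw [mem_dualAnnihilator_vectorSpan_iff, Submodule.mem_span_pair]
  constructor
  · intro hf
    obtain ⟨j, hjd, hj⟩ := h.exists_eq_one hS
    set g : ℕ → ℝ := fun p => f (Pi.single (σ (clamp d p)) 1) with hg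
    have hstep : ∀ i, g (i + 1) - g i = (g (j + 1) - g j) * ε i := fun i => by
      rcases Nat.lt_or_ge i d with hi | hi
      · by_cases h0 : ε i = 0
        · rw [h0, Nat.cast_zero, mul_zero, sub_eq_zero]
          refine h.apply_single_eq_of_height_eq hαβ hf ?_
          have h1 : (clamp d (i + 1) : ℕ) = i + 1 := min_eq_left hi
          have h2 : (clamp d i : ℕ) = i := min_eq_left hi.le
          rw [h1, h2, height_succ, h0, add_zero]
        · have h1 : ε i = 1 := by have := h.le_one i; omega
          rw [h1, Nat.cast_one, mul_one]
          rcases lt_trichotomy i j with hij | rfl | hij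
          · exact h.sub_eq_sub_of_eq_one hαβ hf hij hjd h1 hj
          · rfl
          · exact (h.sub_eq_sub_of_eq_one hαβ hf hij hi hj h1).symm
      · simp only [hg]
        rw [clamp_of_le hi, clamp_of_le (by omega), h.eq_zero i hi, sub_self, Nat.cast_zero,
          mul_zero]
    have hsum : ∀ p, g p = g 0 + (g (j + 1) - g j) * height ε p := fun p => by
      induction p with
      | zero => simp [height]
      | succ p ih =>
        rw [height_succ, Nat.cast_add, mul_add, ← hstep p, ← add_assoc, ← ih]
        ring
    -- Blocks are numbered from 1 but heights from 0, so one slope is taken off the constant.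
    refine ⟨g 0 - (g (j + 1) - g j), g (j + 1) - g j, ?_⟩
    rw [eq_dotLinear f]
    ext i
    obtain ⟨p, rfl⟩ := σ.surjective i
    have h1 := hsum p
    simp only [hg, clamp_val] at h1
    simp only [LinearMap.add_apply, LinearMap.smul_apply, LinearMap.comp_apply,
      LinearMap.single_apply, dotLinear_apply_single, h.eVec_apply]
    rw [h1]
    simp only [hg, Pi.one_apply, smul_eq_mul]
    ring
  · rintro ⟨a, c, rfl⟩ x hx y hy
    simp only [LinearMap.add_apply, LinearMap.smul_apply, dotLinear_one_apply_of_mem hx.1,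
      dotLinear_one_apply_of_mem hy.1, dotLinear_apply, hx.2, hy.2]

theorem finrank_span_pair (h : IsSorting S σ ε) (hS : S.Nontrivial) :
    Module.finrank ℝ (Submodule.span ℝ
      {dotLinear (1 : Fin (d + 1) → ℝ), dotLinear S.eVec}) = 2 := by
  have hli : LinearIndependent ℝ ![dotLinear (1 : Fin (d + 1) → ℝ), dotLinear S.eVec] := by
    rw [LinearIndependent.pair_iff]
    intro a c hac
    obtain ⟨j, hjd, hj⟩ := h.exists_eq_one hS
    have h1 : ∀ x, a + c * S.eVec x = 0 := fun x => by
      have := LinearMap.congr_fun hac (Pi.single x 1)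
      simpa [dotLinear_apply_single] using this
    have h2 := h1 (σ (clamp d (j + 1)))
    have h3 := h1 (σ (clamp d j))
    have h4 := h.eVec_sub_eVec j
    rw [hj, Nat.cast_one] at h4
    have h5 : c = 0 := by
      have : c * (S.eVec (σ (clamp d (j + 1))) - S.eVec (σ (clamp d j))) = 0 := by linarith
      rwa [h4, mul_one] at this
    rw [h5, zero_mul, add_zero] at h2
    exact ⟨h2, h5⟩
  have := finrank_span_eq_card hli
  rwa [Matrix.range_cons_cons_empty, Fintype.card_fin] at this

end IsSorting

theorem isFacetDefining_eVec (hαβ : IsTreeAppropriate α β) (hS : S.Nontrivial) :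
    IsFacetDefining (permAsso α β) S.eVec (bound α β S) := by
  obtain ⟨σ, ε, h⟩ := exists_isSorting S
  obtain ⟨T, hT, hheap⟩ := exists_isHeap d fun i => ε i
  have hv := h.vertex_mem_face hαβ hT hheap
  refine ⟨⟨_, hv⟩, fun _ => ⟨LinearMap.toContinuousLinearMap (dotLinear S.eVec), ?_⟩, ?_⟩
  · ext x
    simp only [Set.mem_ofPred_eq, LinearMap.coe_toContinuousLinearMap', dotLinear_apply]
    refine and_congr_right fun hx => ⟨fun hxb y hy => ?_, fun hmax => ?_⟩
    · rw [hxb]; exact eVec_dotProduct_le_bound hαβ S hy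
    · exact le_antisymm (eVec_dotProduct_le_bound hαβ S hx) (hv.2 ▸ hmax _ hv.1)
  -- The annihilators have dimensions 1 and 2, so the spans differ by one dimension.
  · have h1 := Subspace.finrank_add_finrank_dualAnnihilator_eq (vectorSpan ℝ (permAsso α β))
    have h2 := Subspace.finrank_add_finrank_dualAnnihilator_eq
      (vectorSpan ℝ {x ∈ permAsso α β | S.eVec ⬝ᵥ x = bound α β S})
    rw [dualAnnihilator_vectorSpan_permAsso hαβ, finrank_span_singleton] at h1
    · rw [h.dualAnnihilator_vectorSpan_face hαβ hS, h.finrank_span_pair hS] at h2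
      omega
    · intro h0
      have := LinearMap.congr_fun h0 (Pi.single 0 1)
      rw [dotLinear_apply_single] at this
      simp at this

end

end

end NestedPermutoAssociahedron

theorem theorem6p5 (d : ℕ) (α : Fin (d + 1) → ℝ) (β : Fin d → ℝ)
    (h : NestedPermutoAssociahedron.IsTreeAppropriate α β) :
    NestedPermutoAssociahedron.permAsso α β =
        {x ∈ NestedPermutoAssociahedron.U α |
          ∀ S : NestedPermutoAssociahedron.OrderedSetPartition (d + 1), S.Nontrivial →
            S.eVec ⬝ᵥ x ≤ NestedPermutoAssociahedron.bound α β S} ∧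
      ∀ S : NestedPermutoAssociahedron.OrderedSetPartition (d + 1), S.Nontrivial →
        NestedPermutoAssociahedron.IsFacetDefining (NestedPermutoAssociahedron.permAsso α β)
          S.eVec (NestedPermutoAssociahedron.bound α β S) := by
  refine ⟨Set.Subset.antisymm (fun x hx => ?_) fun x hx => ?_, fun S hS => ?_⟩
  · exact ⟨NestedPermutoAssociahedron.sum_eq_of_mem_permAsso hx,
      fun S _ => NestedPermutoAssociahedron.eVec_dotProduct_le_bound h S hx⟩
  · exact NestedPermutoAssociahedron.mem_permAsso_of_forall_le h hx.1 hx.2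
  · exact NestedPermutoAssociahedron.isFacetDefining_eVec h hS
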